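/- Fix an infinite set $V$ of variables, a set $A$ of actions with $|A|\le|V|$, and a signature $\Sigma$ of function symbols $f$ with finite arities $ar(f)$ and $|\Sigma|\le|V|$. Let $\mathbb T(\Sigma)$ be the set of terms over $\Sigma$ and $V$, and $T(\Sigma)$ the set of closed terms. **TSSs.** A positive literal is an expression $t\xrightarrow{a}t'$, a negative literal an expression $t\not\xrightarrow{a}$ ($t,t'\in\mathbb T(\Sigma)$, $a\in A$); $t\xrightarrow{a}t'$ and $t\not\xrightarrow{a}$ deny each other. A transition rule $\frac{H}{\alpha}$ consists of a (possibly infinite) set $H$ of literals (premises) and a literal $\alpha$ (conclusion); the left-hand side of $\alpha$ is the source, its right-hand side (if any) the target. A transition system specification (TSS) $P=(\Sigma,R)$ is a signature with a set $R$ of transition rules; it is *standard* if all its rules have positive conclusions. $P\vdash\frac{N}{\gamma}$ means that $\gamma$ can be derived by a well-founded proof tree from hypotheses in $N$ by means of substitution instances of rules in $R$. A closed literal $\alpha$ is *$ws$-provable*, $P\vdash_{ws}\alpha$, if it is the root of a well-founded tree of closed literals such that for every node $\beta$, with $K$ the set of labels of the nodes directly above it, either $\frac{K}{\beta}$ is a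 closed substitution instance of a rule in $R$, or $\beta$ is negative and for every set $N$ of closed negative literals with $P\vdash\frac{N}{\gamma}$ for some closed $\gamma$ denying $\beta$, some literal in $K$ denies one in $N$. **Preorders.** Failure observations are given by $\varphi::=\top\mid a\varphi'\mid\bigwedge_{i\in I}\widetilde{a_i}$, and failure trace observations by $\varphi::=\top\mid a\varphi'\mid\bigwedge_{i\in I}\widetilde{a_i}\wedge\varphi'$, with arbitrary index sets $I$. For $p\in T(\Sigma)$: $p\models_P\top$ always; $p\models_P a\varphi$ iff $P\vdash_{ws}p\xrightarrow{a}q$ and $q\models_P\varphi$ for some $q\in T(\Sigma)$; $p\models_P\widetilde a$ iff $P\vdash_{ws}p\not\xrightarrow{a}$; conjunctions are interpreted as usual. The failure (resp. failure trace) preorder induced by $P$ relates $p$ to $q$ iff every failure (resp. failure trace) observation satisfied by $p$ is satisfied by $q$. A preorder $\sqsubseteq$ on $T(\Sigma)$ is a *precongruence* if, for all $f\in\Sigma$, $p_i\sqsubseteq q_i$ for $i=1,\dots,ar(f)$ implies $f(p_1,\dots,p_{ar(f)})\sqsubseteq f(q_1,\dots,q_{ar(f)})$. **Failure trace format.** A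 rule is an *ntytt rule* if the right-hand sides of its positive premises are pairwise distinct variables that do not occur in the source; it is an *ntyxt rule* if moreover the source is a variable, and an *ntyft rule* if moreover the source is $f(x_1,\dots,x_{ar(f)})$ with distinct variables $x_i$. It has *no lookahead* if no variable occurring in the right-hand side of a positive premise occurs in the left-hand side of a premise. An occurrence of a variable is *propagated* if it is in the target, or in the left-hand side of a positive premise whose right-hand side occurs in the target; it is *polled* if it is in the left-hand side of a premise that does not have a right-hand side occurring in the target. Let $\Lambda$ be a predicate on the pairs $(f,i)$ with $f\in\Sigma$, $1\le i\le ar(f)$. An occurrence of $x$ in a term $t$ is *at a $\Lambda$-liquid position* if $t=x$, or $t=f(t_1,\dots,t_{ar(f)})$ and for some $i$ with $\Lambda(f,i)$ it is an occurrence in $t_i$ at a $\Lambda$-liquid position of $t_i$. A variable is *$\Lambda$-floating* in an ntytt rule if it is the right-hand side of a positive premise, or it occurs exactly once in the source, at a $\Lambda$-liquid position. An ntytt rule with a positive conclusion is *$\Lambda$-failure trace safe* if it has no lookahead and each $\Lambda$-floating variable (i) has at most one propagated occurrence, which must be at a $\Lambda$-liquid position; (ii) does not have both propagated and polled occurrences;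 and (iii) has at most one polled occurrence, which must be at a $\Lambda$-liquid position in a positive premise. A standard TSS is in *failure trace format* if all its rules are ntyft or ntyxt rules and, for some $\Lambda$, all its rules are $\Lambda$-failure trace safe. **Theorem.** If a standard TSS $P$ is in failure trace format, then the failure trace preorder and the failure preorder that $P$ induces are both precongruences. -/

import Mathlib

universe u v w

/-! ### Signatures, terms, substitutions -/

/-- A signature: a collection of function symbols with an arity function. -/
structure Signature where
  /-- the function symbols -/
  Sym : Type u
  /-- the arity function -/
  ar : Sym → ℕ

/-- Terms over the signature `S` with variables from `V`. -/
inductive Term (S : Signature.{u}) (V : Type v) : Type (max u v)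
  | var (x : V) : Term S V
  | app (f : S.Sym) (ts : Fin (S.ar f) → Term S V) : Term S V

namespace Term

variable {S : Signature.{u}} {V : Type v}

/-- The set of variables that occur in a term. -/
def vars : Term S V → Set V
  | var x => {x}
  | app _ ts => ⋃ i, (ts i).vars

/-- A term is closed if no variable occurs in it. -/
def IsClosed (t : Term S V) : Prop := t.vars = ∅

/-- Applying a substitution.  A partial substitution is represented by the total one that maps
each variable outside its domain to itself. -/
def subst (σ : V → Term S V) : Term S V → Term S V
  | var x => σ x
  | app f ts => app f (fun i => (ts i).subst σ)

/-- `OccAt x t p`: the variable `x` occurs in the term `t` at position `p`, where a position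
lists the (0-based) argument numbers on the path from the root to the occurrence. -/
inductive OccAt (x : V) : Term S V → List ℕ → Prop
  | here : OccAt x (var x) []
  | arg (f : S.Sym) (ts : Fin (S.ar f) → Term S V) (i : Fin (S.ar f)) (p : List ℕ) :
      OccAt x (ts i) p → OccAt x (app f ts) ((i : ℕ) :: p)

/-- `LiquidAt Λ x t p`: the variable `x` occurs in `t` at position `p`, and this occurrence is at a
`Λ`-liquid position: the path from the root to it passes through liquid arguments only.
`Λ f i` says that argument `i` of `f` is liquid. -/
inductive LiquidAt (Λ : (f : S.Sym) → Fin (S.ar f) → Prop) (x : V) : Term S V → List ℕ → Prop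
  | here : LiquidAt Λ x (var x) []
  | arg (f : S.Sym) (ts : Fin (S.ar f) → Term S V) (i : Fin (S.ar f)) (p : List ℕ) :
      Λ f i → LiquidAt Λ x (ts i) p → LiquidAt Λ x (app f ts) ((i : ℕ) :: p)

end Term

/-- The set `T(Σ)` of closed terms. -/
def ClosedTerm (S : Signature.{u}) (V : Type v) : Type (max u v) :=
  {t : Term S V // t.IsClosed}

/-- The closed term `f(p₁,…,pₙ)` for closed terms `pᵢ`. -/
def ClosedTerm.app {S : Signature.{u}} {V : Type v} (f : S.Sym)
    (p : Fin (S.ar f) → ClosedTerm S V) : ClosedTerm S V :=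
  ⟨Term.app f (fun i => (p i).1), Set.iUnion_eq_empty.2 fun i => (p i).2⟩

/-! ### Literals, transition rules, transition system specifications -/

/-- `pos t a t'` is the positive literal `t —a→ t'`; `neg t a` is the negative literal `t —a↛`. -/
inductive Literal (S : Signature.{u}) (V : Type v) (A : Type w) : Type (max u v w)
  | pos (t : Term S V) (a : A) (t' : Term S V) : Literal S V A
  | neg (t : Term S V) (a : A) : Literal S V A

namespace Literal

variable {S : Signature.{u}} {V : Type v} {A : Type w}

/-- The left-hand side of a literal. -/
def lhs : Literal S V A → Term S V
  | pos t _ _ => t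
  | neg t _ => t

/-- The right-hand side of a literal, if any. -/
def rhs : Literal S V A → Option (Term S V)
  | pos _ _ t' => some t'
  | neg _ _ => none

/-- Applying a substitution to a literal. -/
def subst (σ : V → Term S V) : Literal S V A → Literal S V A
  | pos t a t' => pos (t.subst σ) a (t'.subst σ)
  | neg t a => neg (t.subst σ) a

/-- A literal is closed if it contains no variables. -/
def IsClosed : Literal S V A → Prop
  | pos t _ t' => t.IsClosed ∧ t'.IsClosed
  | neg t _ => t.IsClosed

/-- The literal is positive. -/
def IsPos (l : Literal S V A) : Prop := ∃ t a t', l = pos t a t'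

/-- The literal is negative. -/
def IsNeg (l : Literal S V A) : Prop := ∃ t a, l = neg t a

/-- The literals `t —a→ t'` and `t —a↛` deny each other. -/
inductive Denies : Literal S V A → Literal S V A → Prop
  | pos_neg (t : Term S V) (a : A) (t' : Term S V) : Denies (pos t a t') (neg t a)
  | neg_pos (t : Term S V) (a : A) (t' : Term S V) : Denies (neg t a) (pos t a t')

end Literal

/-- A transition rule: a (possibly infinite) set of premises and a conclusion. -/
structure TransRule (S : Signature.{u}) (V : Type v) (A : Type w) where
  /-- the premises -/
  prem : Set (Literal S V A)
  /-- the conclusion -/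
  concl : Literal S V A

/-- A transition system specification over the signature `S`. -/
structure TSS (S : Signature.{u}) (V : Type v) (A : Type w) where
  /-- the transition rules -/
  rules : Set (TransRule S V A)

section Provability

variable {S : Signature.{u}} {V : Type v} {A : Type w}

/-- A TSS is standard if all its rules have positive conclusions. -/
def TSS.IsStandard (P : TSS S V A) : Prop := ∀ r ∈ P.rules, r.concl.IsPos

/-- `P.Provable H α`: the transition rule `H / α` is provable from `P`, that is, there is a
well-founded, upwardly branching proof tree with root `α`, all of whose hypotheses are in `H`
and all of whose other nodes are inferred by substitution instances of rules of `P`. -/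
inductive TSS.Provable (P : TSS S V A) (H : Set (Literal S V A)) : Literal S V A → Prop
  | hyp (α : Literal S V A) : α ∈ H → TSS.Provable P H α
  | rule (r : TransRule S V A) (σ : V → Term S V) : r ∈ P.rules →
      (∀ β ∈ r.prem, TSS.Provable P H (β.subst σ)) → TSS.Provable P H (r.concl.subst σ)

/-- `P.WSProvable α`: there is a well-supported proof of the (closed) literal `α` from `P`.
The constructor `rule` is an inference by a closed substitution instance of a rule of `P`.
In the constructor `denial`, the negative literal `t —a↛` is inferred from a set `K` of
well-supportedly proven literals such that for every set `N` of negative closed literals from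
which some closed literal denying `t —a↛` is provable, a literal in `K` denies one in `N`. -/
inductive TSS.WSProvable (P : TSS S V A) : Literal S V A → Prop
  | rule (r : TransRule S V A) (σ : V → ClosedTerm S V) : r ∈ P.rules →
      (∀ β ∈ r.prem, TSS.WSProvable P (β.subst fun x => (σ x).1)) →
      TSS.WSProvable P (r.concl.subst fun x => (σ x).1)
  | denial (t : Term S V) (a : A) (K : Set (Literal S V A)) : t.IsClosed →
      (∀ δ ∈ K, TSS.WSProvable P δ) →
      (∀ N : Set (Literal S V A), (∀ ν ∈ N, ν.IsNeg ∧ ν.IsClosed) →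
        ∀ γ : Literal S V A, γ.IsClosed → γ.Denies (Literal.neg t a) → P.Provable N γ →
          ∃ δ ∈ K, ∃ ν ∈ N, δ.Denies ν) →
      TSS.WSProvable P (Literal.neg t a)

end Provability

/-! ### Observations and the induced preorders -/

/-- Modal formulas over the action set `A` built from `⊤`, `aφ`, `ã` and arbitrary (possibly
infinite or empty) conjunctions. -/
inductive Obs (A : Type w) : Type (w + 1)
  | top : Obs A
  | act (a : A) (φ : Obs A) : Obs A
  | refuse (a : A) : Obs A
  | conj {I : Type w} (φ : I → Obs A) : Obs A

/-- Binary conjunction. -/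
def Obs.and {A : Type w} (φ ψ : Obs A) : Obs A :=
  Obs.conj (I := ULift.{w} Bool) fun b => if b.down then φ else ψ

/-- Failure observations: `φ ::= ⊤ | aφ' | ⋀_{i ∈ I} ãᵢ`. -/
inductive Obs.IsFailure {A : Type w} : Obs A → Prop
  | top : Obs.IsFailure Obs.top
  | act (a : A) (φ : Obs A) : Obs.IsFailure φ → Obs.IsFailure (Obs.act a φ)
  | refusals {I : Type w} (a : I → A) : Obs.IsFailure (Obs.conj fun i => Obs.refuse (a i))

/-- Failure trace observations: `φ ::= ⊤ | aφ' | ⋀_{i ∈ I} ãᵢ ∧ φ'`. -/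
inductive Obs.IsFailureTrace {A : Type w} : Obs A → Prop
  | top : Obs.IsFailureTrace Obs.top
  | act (a : A) (φ : Obs A) : Obs.IsFailureTrace φ → Obs.IsFailureTrace (Obs.act a φ)
  | refusals {I : Type w} (a : I → A) (φ : Obs A) : Obs.IsFailureTrace φ →
      Obs.IsFailureTrace (Obs.and (Obs.conj fun i => Obs.refuse (a i)) φ)

section Preorders

variable {S : Signature.{u}} {V : Type v} {A : Type w}

/-- The satisfaction relation `p ⊨_P φ` between closed terms and observations. -/
def TSS.Sat (P : TSS S V A) : Obs A → ClosedTerm S V → Prop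
  | Obs.top, _ => True
  | Obs.act a φ, p => ∃ q : ClosedTerm S V, P.WSProvable (Literal.pos p.1 a q.1) ∧ P.Sat φ q
  | Obs.refuse a, p => P.WSProvable (Literal.neg p.1 a)
  | Obs.conj φ, p => ∀ i, P.Sat (φ i) p

/-- The failure preorder induced by `P`: inclusion of the sets of failure observations. -/
def TSS.FailurePreorder (P : TSS S V A) (p q : ClosedTerm S V) : Prop :=
  {φ : Obs A | φ.IsFailure ∧ P.Sat φ p} ⊆ {φ : Obs A | φ.IsFailure ∧ P.Sat φ q}

/-- The failure trace preorder induced by `P`: inclusion of the sets of failure trace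
observations. -/
def TSS.FailureTracePreorder (P : TSS S V A) (p q : ClosedTerm S V) : Prop :=
  {φ : Obs A | φ.IsFailureTrace ∧ P.Sat φ p} ⊆ {φ : Obs A | φ.IsFailureTrace ∧ P.Sat φ q}

/-- A relation on closed terms is a precongruence if it is a preorder that is preserved by all
function symbols. -/
structure IsPrecongruence (R : ClosedTerm S V → ClosedTerm S V → Prop) : Prop where
  refl : ∀ p, R p p
  trans : ∀ p q r, R p q → R q r → R p r
  app : ∀ (f : S.Sym) (p q : Fin (S.ar f) → ClosedTerm S V),
    (∀ i, R (p i) (q i)) → R (ClosedTerm.app f p) (ClosedTerm.app f q)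

end Preorders

/-! ### The failure trace format -/

namespace TransRule

variable {S : Signature.{u}} {V : Type v} {A : Type w}

/-- The source of a rule: the left-hand side of its conclusion. -/
def source (r : TransRule S V A) : Term S V := r.concl.lhs

/-- The variable `x` occurs in the target (the right-hand side of the conclusion, if any). -/
def InTarget (r : TransRule S V A) (x : V) : Prop := ∃ u ∈ r.concl.rhs, x ∈ u.vars

/-- The variable `x` is the right-hand side of a positive premise. -/
def IsPremRhs (r : TransRule S V A) (x : V) : Prop :=
  ∃ t a, Literal.pos t a (Term.var x) ∈ r.prem

/-- ntytt rules: the right-hand sides of positive premises are variables that are all distinct and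
that do not occur in the source. -/
structure IsNtytt (r : TransRule S V A) : Prop where
  rhs_var : ∀ t a t', Literal.pos t a t' ∈ r.prem → ∃ y, t' = Term.var y ∧ y ∉ r.source.vars
  distinct : ∀ t a t' b y, Literal.pos t a (Term.var y) ∈ r.prem →
    Literal.pos t' b (Term.var y) ∈ r.prem → t = t' ∧ a = b

/-- ntyxt rules: ntytt rules whose source is a variable. -/
def IsNtyxt (r : TransRule S V A) : Prop := r.IsNtytt ∧ ∃ x, r.source = Term.var x

/-- ntyft rules: ntytt rules whose source is of the form `f(x₁,…,xₙ)` with the `xᵢ` distinct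
variables. -/
def IsNtyft (r : TransRule S V A) : Prop :=
  r.IsNtytt ∧ ∃ (f : S.Sym) (x : Fin (S.ar f) → V), Function.Injective x ∧
    r.source = Term.app f (fun i => Term.var (x i))

/-- No variable occurring in the right-hand side of a positive premise occurs in the left-hand side
of a premise. -/
def NoLookahead (r : TransRule S V A) : Prop :=
  ∀ t a t', Literal.pos t a t' ∈ r.prem → ∀ y ∈ t'.vars, ∀ l ∈ r.prem, y ∉ l.lhs.vars

/-- A place in a rule: a position in the target, or a position in the left-hand side of a given
premise. -/
inductive Place (S : Signature.{u}) (V : Type v) (A : Type w) : Type (max u v w)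
  | target (p : List ℕ) : Place S V A
  | premLhs (l : Literal S V A) (p : List ℕ) : Place S V A

/-- The literal `l` has a right-hand side that is a variable occurring in the target. -/
def RhsInTarget (r : TransRule S V A) (l : Literal S V A) : Prop :=
  ∃ y, Term.var y ∈ l.rhs ∧ r.InTarget y

/-- `r.Propagated x o`: there is an occurrence of `x` at place `o` of `r`, and it is propagated: it
is in the target, or in the left-hand side of a positive premise whose right-hand side occurs in
the target. -/
inductive Propagated (r : TransRule S V A) (x : V) : Place S V A → Prop
  | target (u : Term S V) (p : List ℕ) : u ∈ r.concl.rhs → u.OccAt x p →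
      Propagated r x (Place.target p)
  | premLhs (l : Literal S V A) (p : List ℕ) : l ∈ r.prem → r.RhsInTarget l → l.lhs.OccAt x p →
      Propagated r x (Place.premLhs l p)

/-- `r.Polled x o`: there is an occurrence of `x` at place `o` of `r`, and it is polled: it is in
the left-hand side of a premise that does not have a right-hand side occurring in the target. -/
inductive Polled (r : TransRule S V A) (x : V) : Place S V A → Prop
  | premLhs (l : Literal S V A) (p : List ℕ) : l ∈ r.prem → ¬ r.RhsInTarget l → l.lhs.OccAt x p →
      Polled r x (Place.premLhs l p)

/-- The occurrence of `x` at the given place is at a `Λ`-liquid position (of the target, or of the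
left-hand side of the premise). -/
def LiquidPlace (Λ : (f : S.Sym) → Fin (S.ar f) → Prop) (r : TransRule S V A) (x : V) :
    Place S V A → Prop
  | Place.target p => ∃ u ∈ r.concl.rhs, u.LiquidAt Λ x p
  | Place.premLhs l p => l.lhs.LiquidAt Λ x p

/-- The place is in a positive premise. -/
def InPosPrem : Place S V A → Prop
  | Place.target _ => False
  | Place.premLhs l _ => l.IsPos

/-- `Λ`-floating variables: right-hand sides of positive premises, and variables that occur exactly
once in the source, at a `Λ`-liquid position. -/
def Floating (Λ : (f : S.Sym) → Fin (S.ar f) → Prop) (r : TransRule S V A) (x : V) : Prop :=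
  r.IsPremRhs x ∨ ∃ p, r.source.LiquidAt Λ x p ∧ ∀ q, r.source.OccAt x q → q = p

/-- `Λ`-ready trace safe rules. -/
structure ReadyTraceSafe (Λ : (f : S.Sym) → Fin (S.ar f) → Prop) (r : TransRule S V A) :
    Prop where
  no_lookahead : r.NoLookahead
  propagated_once : ∀ x, r.Floating Λ x → ∀ o o', r.Propagated x o → r.Propagated x o' → o = o'
  propagated_liquid : ∀ x, r.Floating Λ x → ∀ o, r.Propagated x o → r.LiquidPlace Λ x o

/-- `Λ`-readiness safe rules. -/
structure ReadinessSafe (Λ : (f : S.Sym) → Fin (S.ar f) → Prop) (r : TransRule S V A) : Prop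
    extends ReadyTraceSafe Λ r where
  not_both : ∀ x, r.Floating Λ x → ¬ ((∃ o, r.Propagated x o) ∧ ∃ o, r.Polled x o)

/-- `Λ`-failure trace safe rules. -/
structure FailureTraceSafe (Λ : (f : S.Sym) → Fin (S.ar f) → Prop) (r : TransRule S V A) : Prop
    extends ReadinessSafe Λ r where
  polled_once : ∀ x, r.Floating Λ x → ∀ o o', r.Polled x o → r.Polled x o' → o = o'
  polled_liquid : ∀ x, r.Floating Λ x → ∀ o, r.Polled x o → r.LiquidPlace Λ x o
  polled_pos : ∀ x, r.Floating Λ x → ∀ o, r.Polled x o → InPosPrem o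

end TransRule

/-- A TSS is in ntyft/ntyxt format if it contains only ntyft and ntyxt rules. -/
def TSS.InNtyftNtyxtFormat {S : Signature.{u}} {V : Type v} {A : Type w} (P : TSS S V A) : Prop :=
  ∀ r ∈ P.rules, r.IsNtyft ∨ r.IsNtyxt

/-- A (standard) TSS is in failure trace format if it is in ntyft/ntyxt format and its rules are
`Λ`-failure trace safe with respect to some `Λ`. -/
def TSS.InFailureTraceFormat {S : Signature.{u}} {V : Type v} {A : Type w} (P : TSS S V A) :
    Prop :=
  P.InNtyftNtyxtFormat ∧
    ∃ Λ : (f : S.Sym) → Fin (S.ar f) → Prop, ∀ r ∈ P.rules, r.FailureTraceSafe Λ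

/-! Both preorders are inclusion of observations (`ObsLE`), so it suffices that an observation of
`f(p₁,…,pₙ)` is forced by observations of the arguments. `Decomposes` generalises this to open terms
`t` whose variables are of two kinds: those in `X`, linear and at liquid positions, about which only
one observation `ψ x` is known; and all others, where the new process satisfies every observation of
the old one, so that copying and frozen positions are harmless. The theorem is the case `X = ∅`;
members of `X` arise from right-hand sides of premises, which are known only through the observation
that the target needs.

For an observation `aφ` the argument follows a derivation of the transition. If the last rule has
target `u`, decompose `φ` along `u`, with the right-hand sides `y` of premises added to `X`; the
observation obtained for `y` is then what the premise producing `y` has to meet, and the derivation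
above that premise is decomposed in turn (`decomposes_act`). Failure observations are not closed
under conjunction, so the demands that target and premises make on one `x ∈ X` could not be combined
in general. The format excludes the conflict: a floating variable occurs at most once in target and
premises together (`place_unique`), so a single demand remains.

Refusals need no decomposition: since conjunctions of refusals may be infinite, the set of all
refusals of `ρ x` is itself an observation. That it suffices is `transfer`. Here well-supportedness
matters: a refusal holds iff no transition is derivable from the negative literals that no provable
transition denies (`refuses_iff`), so refusals are preserved by transforming derivations backwards,
from the new process to the old one. Negative premises survive because the format keeps `X` out of
them.

Instead of composing rules into new ones, each rule application replaces a term over `W` by terms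
over `W ⊕ V`: the old variables, plus the rule variables that do not occur in the source, valued by
the closed instance. -/

namespace Term

/-! ### Evaluation, substitution and occurrences in open terms. -/

variable {S : Signature.{u}} {V W : Type v}

/-- The closed term obtained from a term by replacing its variables by closed terms. -/
def eval (ρ : W → ClosedTerm S V) : Term S W → ClosedTerm S V
  | var x => ρ x
  | app f ts => ClosedTerm.app f fun i => (ts i).eval ρ

/-- Simultaneous substitution, possibly changing the type of variables. -/
def bind (κ : V → Term S W) : Term S V → Term S W
  | var x => κ x
  | app f ts => app f fun i => (ts i).bind κ

theorem subst_coe (σ : V → ClosedTerm S V) (t : Term S V) :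
    t.subst (fun x => (σ x).1) = (t.eval σ).1 := by
  induction t with
  | var x => rfl
  | app f ts ih => simp only [subst, eval, ClosedTerm.app, ih]

theorem eval_subst (σ : V → Term S V) (ρ : V → ClosedTerm S V) (t : Term S V) :
    (t.subst σ).eval ρ = t.eval fun x => (σ x).eval ρ := by
  induction t with
  | var x => rfl
  | app f ts ih => simp only [subst, eval, ih]

theorem eval_bind {U : Type v} (κ : U → Term S W) (ρ : W → ClosedTerm S V) (t : Term S U) :
    (t.bind κ).eval ρ = t.eval fun x => (κ x).eval ρ := by
  induction t with
  | var x => rfl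
  | app f ts ih => simp only [bind, eval, ih]

theorem eval_congr {ρ ρ' : W → ClosedTerm S V} {t : Term S W} (h : ∀ x ∈ t.vars, ρ x = ρ' x) :
    t.eval ρ = t.eval ρ' := by
  induction t with
  | var x => exact h x rfl
  | app f ts ih =>
    simp only [eval]
    congr 1
    funext i
    exact ih i fun x hx => h x (Set.mem_iUnion.2 ⟨i, hx⟩)

theorem eval_of_isClosed (ρ : V → ClosedTerm S V) {t : Term S V} (h : t.IsClosed) :
    (t.eval ρ).1 = t := by
  induction t with
  | var x => exact absurd h (Set.singleton_ne_empty x)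
  | app f ts ih =>
    simp only [eval, ClosedTerm.app]
    congr 1
    funext i
    exact ih i (Set.iUnion_eq_empty.1 h i)

theorem eq_of_eval_eq {ρ ρ' : W → ClosedTerm S V} {t : Term S W} (h : t.eval ρ = t.eval ρ') :
    ∀ x ∈ t.vars, ρ x = ρ' x := by
  induction t with
  | var x => rintro y rfl; exact h
  | app f ts ih =>
    intro x hx
    obtain ⟨i, hi⟩ := Set.mem_iUnion.1 hx
    have h1 := congrArg Subtype.val h
    simp only [eval, ClosedTerm.app, app.injEq, heq_eq_eq, true_and] at h1
    exact ih i (Subtype.ext (congrFun h1 i)) x hi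

/-! ### Occurrences -/

theorem mem_vars_iff {x : V} {t : Term S V} : x ∈ t.vars ↔ ∃ p, t.OccAt x p := by
  constructor
  · induction t with
    | var y => rintro rfl; exact ⟨_, .here⟩
    | app f ts ih =>
      intro h
      obtain ⟨i, hi⟩ := Set.mem_iUnion.1 h
      obtain ⟨p, hp⟩ := ih i hi
      exact ⟨_, .arg f ts i p hp⟩
  · rintro ⟨p, hp⟩
    induction hp with
    | here => exact rfl
    | arg f ts i p _ ih => exact Set.mem_iUnion.2 ⟨i, ih⟩

theorem OccAt.mem_vars {x : V} {t : Term S V} {p : List ℕ} (h : t.OccAt x p) : x ∈ t.vars :=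
  mem_vars_iff.2 ⟨p, h⟩

theorem occAt_var {x y : V} {p : List ℕ} (h : (var (S := S) y).OccAt x p) : y = x ∧ p = [] := by
  cases h
  exact ⟨rfl, rfl⟩

theorem occAt_bind {κ : V → Term S W} {t : Term S V} {x : W} {p : List ℕ}
    (h : (t.bind κ).OccAt x p) :
    ∃ z p₁ p₂, t.OccAt z p₁ ∧ (κ z).OccAt x p₂ ∧ p = p₁ ++ p₂ := by
  induction t generalizing p with
  | var z => exact ⟨z, [], p, .here, h, rfl⟩
  | app f ts ih =>
    cases h with
    | arg _ _ i q hq =>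
      obtain ⟨z, p₁, p₂, h₁, h₂, rfl⟩ := ih i hq
      exact ⟨z, _, p₂, .arg f ts i p₁ h₁, h₂, rfl⟩

theorem OccAt.bind {κ : V → Term S W} {t : Term S V} {x : W} {z : V} {p q : List ℕ}
    (h : t.OccAt z p) (h' : (κ z).OccAt x q) : (t.bind κ).OccAt x (p ++ q) := by
  induction h with
  | here => exact h'
  | arg f ts i p _ ih => exact .arg f _ i _ ih

theorem LiquidAt.bind {Λ : (f : S.Sym) → Fin (S.ar f) → Prop} {κ : V → Term S W} {t : Term S V}
    {x : W} {z : V} {p q : List ℕ} (h : t.LiquidAt Λ z p) (h' : (κ z).LiquidAt Λ x q) :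
    (t.bind κ).LiquidAt Λ x (p ++ q) := by
  induction h with
  | here => exact h'
  | arg f ts i p hi _ ih => exact .arg f _ i _ hi ih

/-- Liquidity is a condition on every step of a path, so it restricts to both halves of the path.
This lets a condition on an instance be read back on the rule. -/
theorem LiquidAt.split {Λ : (f : S.Sym) → Fin (S.ar f) → Prop} {κ : V → Term S W} {t : Term S V}
    {x : W} {z : V} {p q : List ℕ} (h : t.OccAt z p) (h' : (t.bind κ).LiquidAt Λ x (p ++ q)) :
    t.LiquidAt Λ z p ∧ (κ z).LiquidAt Λ x q := by
  induction h with
  | here => exact ⟨.here, h'⟩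
  | arg f ts i p _ ih =>
    generalize hl : (i : ℕ) :: p ++ q = l at h'
    cases h' with
    | arg _ _ j r hj hr =>
      simp only [List.cons_append, List.cons.injEq] at hl
      obtain rfl : i = j := Fin.ext hl.1
      rw [← hl.2] at hr
      exact ⟨.arg f ts i p hj (ih hr).1, (ih hr).2⟩

/-- Variables are leaves, so no occurrence position is a proper prefix of another. -/
theorem OccAt.eq_of_append_eq {t : Term S V} {z z' : V} {p p' q q' : List ℕ} (h : t.OccAt z p)
    (h' : t.OccAt z' p') (e : p ++ q = p' ++ q') : z = z' ∧ p = p' ∧ q = q' := by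
  induction h generalizing p' with
  | here =>
    cases h'
    exact ⟨rfl, rfl, e⟩
  | arg f ts i p _ ih =>
    cases h' with
    | arg _ _ j r hr =>
      simp only [List.cons_append, List.cons.injEq] at e
      obtain rfl : i = j := Fin.ext e.1
      obtain ⟨h₁, h₂, h₃⟩ := ih hr e.2
      exact ⟨h₁, by rw [h₂], h₃⟩

/-- All occurrences in `t` of variables from `X` are at liquid positions. -/
def LiquidIn (Λ : (f : S.Sym) → Fin (S.ar f) → Prop) (X : Set V) (t : Term S V) : Prop :=
  ∀ x ∈ X, ∀ p, t.OccAt x p → t.LiquidAt Λ x p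

/-- Each variable from `X` occurs at most once in `t`. -/
def LinearIn (X : Set V) (t : Term S V) : Prop :=
  ∀ x ∈ X, ∀ p q, t.OccAt x p → t.OccAt x q → p = q

open Classical in
/-- Apply `κ` to the variables in `D`, and keep the other ones. -/
noncomputable def lift (D : Set V) (κ : V → Term S W) (z : V) : Term S (W ⊕ V) :=
  if z ∈ D then (κ z).bind fun w => var (Sum.inl w) else var (Sum.inr z)

variable {D : Set V} {κ : V → Term S W}

theorem eval_lift_of_mem {z : V} (h : z ∈ D) (ρ : W → ClosedTerm S V) (σ : V → ClosedTerm S V) :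
    (lift D κ z).eval (Sum.elim ρ σ) = (κ z).eval ρ := by
  rw [lift, if_pos h, eval_bind]
  rfl

theorem eval_lift_of_notMem {z : V} (h : z ∉ D) (ρ : W → ClosedTerm S V)
    (σ : V → ClosedTerm S V) : (lift D κ z).eval (Sum.elim ρ σ) = σ z := by
  rw [lift, if_neg h]
  rfl

theorem occAt_lift_inl {z : V} {x : W} {p : List ℕ} (h : (lift D κ z).OccAt (Sum.inl x) p) :
    z ∈ D ∧ (κ z).OccAt x p := by
  by_cases hz : z ∈ D
  · rw [lift, if_pos hz] at h
    obtain ⟨w, p₁, p₂, h₁, h₂, rfl⟩ := occAt_bind h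
    cases h₂
    exact ⟨hz, by simpa using h₁⟩
  · rw [lift, if_neg hz] at h
    cases h

theorem occAt_lift_inr {z x : V} {p : List ℕ} (h : (lift D κ z).OccAt (Sum.inr x) p) :
    z = x ∧ z ∉ D ∧ p = [] := by
  by_cases hz : z ∈ D
  · rw [lift, if_pos hz] at h
    obtain ⟨w, p₁, p₂, h₁, h₂, rfl⟩ := occAt_bind h
    cases h₂
  · rw [lift, if_neg hz] at h
    cases h
    exact ⟨rfl, hz, rfl⟩

theorem LiquidAt.lift {Λ : (f : S.Sym) → Fin (S.ar f) → Prop} {z : V} {x : W} {p : List ℕ}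
    (hz : z ∈ D) (h : (κ z).LiquidAt Λ x p) : (lift D κ z).LiquidAt Λ (Sum.inl x) p := by
  rw [Term.lift, if_pos hz]
  simpa using LiquidAt.bind (κ := fun w => Term.var (S := S) (Sum.inl (β := V) w)) h .here

theorem occAt_bind_lift_inl {s : Term S V} {x : W} {p : List ℕ}
    (h : (s.bind (lift D κ)).OccAt (Sum.inl x) p) :
    ∃ z p₁ p₂, z ∈ D ∧ s.OccAt z p₁ ∧ (κ z).OccAt x p₂ ∧ p = p₁ ++ p₂ := by
  obtain ⟨z, p₁, p₂, h₁, h₂, rfl⟩ := occAt_bind h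
  exact ⟨z, p₁, p₂, (occAt_lift_inl h₂).1, h₁, (occAt_lift_inl h₂).2, rfl⟩

theorem occAt_bind_lift_inr {s : Term S V} {x : V} {p : List ℕ}
    (h : (s.bind (lift D κ)).OccAt (Sum.inr x) p) : x ∉ D ∧ s.OccAt x p := by
  obtain ⟨z, p₁, p₂, h₁, h₂, rfl⟩ := occAt_bind h
  obtain ⟨rfl, h₃, rfl⟩ := occAt_lift_inr h₂
  exact ⟨h₃, by simpa using h₁⟩

end Term

/-! ### Well-supported provability on closed terms. -/

section WellSupported

variable {S : Signature.{u}} {V : Type v} {A : Type w}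

/-- Ws-provable transitions between closed terms. -/
def TSS.Step (P : TSS S V A) (p : ClosedTerm S V) (a : A) (q : ClosedTerm S V) : Prop :=
  P.WSProvable (.pos p.1 a q.1)

/-- Ws-provable refusals of closed terms. -/
def TSS.Refuses (P : TSS S V A) (p : ClosedTerm S V) (a : A) : Prop :=
  P.WSProvable (.neg p.1 a)

/-- Transitions between closed terms derivable by closed rule instances, when the negative
premises are taken from `D`. -/
inductive TSS.Der (P : TSS S V A) (D : ClosedTerm S V → A → Prop) :
    ClosedTerm S V → A → ClosedTerm S V → Prop
  | rule (r : TransRule S V A) (σ : V → ClosedTerm S V) (s : Term S V) (a : A) (u : Term S V) :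
      r ∈ P.rules → r.concl = .pos s a u →
      (∀ t b t', Literal.pos t b t' ∈ r.prem → TSS.Der P D (t.eval σ) b (t'.eval σ)) →
      (∀ t b, Literal.neg t b ∈ r.prem → D (t.eval σ) b) →
      TSS.Der P D (s.eval σ) a (u.eval σ)

namespace TSS

variable {P : TSS S V A}

theorem Der.mono {D D' : ClosedTerm S V → A → Prop} (h : ∀ p a, D p a → D' p a)
    {p : ClosedTerm S V} {a : A} {q : ClosedTerm S V} (hd : P.Der D p a q) : P.Der D' p a q := by
  induction hd with
  | rule r σ s a u hr hc _ hn ih => exact .rule r σ s a u hr hc ih fun t b ht => h _ _ (hn t b ht)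

theorem Der.provable {D : ClosedTerm S V → A → Prop} {p : ClosedTerm S V} {a : A}
    {q : ClosedTerm S V} (h : P.Der D p a q) :
    P.Provable {ν | ∃ s b, D s b ∧ ν = .neg s.1 b} (.pos p.1 a q.1) := by
  induction h with
  | rule r σ s a u hr hc _ hn ih =>
    have := Provable.rule (H := {ν | ∃ s b, D s b ∧ ν = .neg s.1 b}) r (fun x => (σ x).1) hr
    simp only [hc, Literal.subst, Term.subst_coe] at this
    refine this fun β hβ => ?_
    cases β with
    | pos t b t' => exact ih t b t' hβ
    | neg t b => exact .hyp _ ⟨_, _, hn t b hβ, rfl⟩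

/-- Proof trees may contain open terms; evaluating the whole tree under one closed valuation `ρ`
turns it into a closed derivation. -/
theorem Der.of_provable (hstd : P.IsStandard) {D : ClosedTerm S V → A → Prop}
    {N : Set (Literal S V A)} {ρ : V → ClosedTerm S V}
    (hN : ∀ ν ∈ N, ∃ s b, ν = .neg s b ∧ D (s.eval ρ) b) {α : Literal S V A}
    (h : P.Provable N α) :
    (∀ s b s', α = .pos s b s' → P.Der D (s.eval ρ) b (s'.eval ρ)) ∧
      ∀ s b, α = .neg s b → D (s.eval ρ) b := by
  induction h with
  | hyp α hα =>
    obtain ⟨s, b, rfl, hD⟩ := hN α hα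
    refine ⟨fun _ _ _ h => (by cases h), fun _ _ h => ?_⟩
    cases h
    exact hD
  | rule r σ hr _ ih =>
    obtain ⟨s, a, u, hc⟩ := hstd r hr
    rw [hc]
    refine ⟨fun _ _ _ h => ?_, fun _ _ h => (by cases h)⟩
    cases h
    rw [Term.eval_subst, Term.eval_subst]
    refine .rule r _ s a u hr hc (fun t b t' ht => ?_) fun t b ht => ?_
    · simpa only [Term.eval_subst] using (ih _ ht).1 _ _ _ rfl
    · simpa only [Term.eval_subst] using (ih _ ht).2 _ _ rfl

theorem WSProvable.isClosed {α : Literal S V A} (h : P.WSProvable α) : α.IsClosed := by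
  cases h with
  | rule r σ hr _ =>
    cases r.concl with
    | pos t a t' =>
      simp only [Literal.subst, Term.subst_coe]
      exact ⟨(t.eval σ).2, (t'.eval σ).2⟩
    | neg t a =>
      simp only [Literal.subst, Term.subst_coe]
      exact (t.eval σ).2
  | denial t a K ht _ _ => exact ht

/-- Rule induction for ws-provability, in terms of closed terms. -/
theorem wsInduction (hstd : P.IsStandard)
    {MP : ClosedTerm S V → A → ClosedTerm S V → Prop} {MN : ClosedTerm S V → A → Prop}
    (hrule : ∀ (r : TransRule S V A) (σ : V → ClosedTerm S V) (s : Term S V) (a : A)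
      (u : Term S V), r ∈ P.rules → r.concl = .pos s a u →
      (∀ t b t', Literal.pos t b t' ∈ r.prem → MP (t.eval σ) b (t'.eval σ)) →
      (∀ t b, Literal.neg t b ∈ r.prem → MN (t.eval σ) b) → MP (s.eval σ) a (u.eval σ))
    (hden : ∀ (p : ClosedTerm S V) (a : A) (K : ClosedTerm S V → A → ClosedTerm S V → Prop),
      (∀ p b q, K p b q → P.Step p b q ∧ MP p b q) →
      (∀ q, ¬ P.Der (fun s b => ¬ ∃ q, K s b q) p a q) → MN p a) :
    (∀ p a q, P.Step p a q → MP p a q) ∧ ∀ p a, P.Refuses p a → MN p a := by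
  have key : ∀ α : Literal S V A, P.WSProvable α →
      (∀ p a q, α = .pos p.1 a q.1 → MP p a q) ∧ ∀ p a, α = .neg p.1 a → MN p a := by
    intro α h
    induction h with
    | rule r σ hr _ ih =>
      obtain ⟨s, a, u, hc⟩ := hstd r hr
      rw [hc]
      simp only [Literal.subst, Term.subst_coe]
      refine ⟨fun p b q h => ?_, fun _ _ h => (by cases h)⟩
      simp only [Literal.pos.injEq] at h
      obtain ⟨h₁, rfl, h₂⟩ := h
      obtain rfl := Subtype.ext h₁
      obtain rfl := Subtype.ext h₂
      refine hrule r σ s a u hr hc (fun t b t' ht => (ih _ ht).1 _ _ _ ?_)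
        fun t b ht => (ih _ ht).2 _ _ ?_
      · simp only [Literal.subst, Term.subst_coe]
      · simp only [Literal.subst, Term.subst_coe]
    | denial t a K ht hK hN ih =>
      refine ⟨fun _ _ _ h => (by cases h), fun p b h => ?_⟩
      cases h
      refine hden p a (fun p b q => .pos p.1 b q.1 ∈ K)
        (fun p b q h => ⟨hK _ h, (ih _ h).1 _ _ _ rfl⟩) fun q hq => ?_
      -- `N` is taken to be the set of all closed negative literals that `K` does not deny. A
      -- derivation from it would give a literal in `K` denying a member of `N`, which is absurd.
      obtain ⟨δ, hδ, ν, ⟨s, b, hs, rfl⟩, hd⟩ := hN _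
        (by rintro _ ⟨s, b, -, rfl⟩; exact ⟨⟨_, _, rfl⟩, s.2⟩) (.pos p.1 a q.1) ⟨p.2, q.2⟩
        (.pos_neg _ _ _) hq.provable
      cases hd with
      | pos_neg _ _ t' => exact hs ⟨⟨t', (hK _ hδ).isClosed.2⟩, hδ⟩
  exact ⟨fun p a q h => (key _ h).1 p a q rfl, fun p a h => (key _ h).2 p a rfl⟩

theorem Step.of_rule {r : TransRule S V A} {σ : V → ClosedTerm S V} {s : Term S V} {a : A}
    {u : Term S V} (hr : r ∈ P.rules) (hc : r.concl = .pos s a u)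
    (hp : ∀ t b t', Literal.pos t b t' ∈ r.prem → P.Step (t.eval σ) b (t'.eval σ))
    (hn : ∀ t b, Literal.neg t b ∈ r.prem → P.Refuses (t.eval σ) b) :
    P.Step (s.eval σ) a (u.eval σ) := by
  have := WSProvable.rule r σ hr
  simp only [hc, Literal.subst, Term.subst_coe] at this
  refine this fun β hβ => ?_
  cases β with
  | pos t b t' => exact hp t b t' hβ
  | neg t b => exact hn t b hβ

theorem Refuses.of_not_der (hstd : P.IsStandard) {p : ClosedTerm S V} {a : A}
    (K : ClosedTerm S V → A → ClosedTerm S V → Prop) (hK : ∀ p b q, K p b q → P.Step p b q)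
    (hd : ∀ q, ¬ P.Der (fun s b => ¬ ∃ q, K s b q) p a q) : P.Refuses p a := by
  refine .denial _ _ {δ | ∃ s b t, K s b t ∧ δ = .pos s.1 b t.1} p.2 ?_ ?_
  · rintro _ ⟨s, b, t, h, rfl⟩
    exact hK s b t h
  · intro N hN γ hγ hden hprov
    by_contra! hcon
    cases hden with
    | pos_neg _ _ t' =>
      refine hd ⟨t', hγ.2⟩ ?_
      -- `p` serves as an arbitrary closed term to fill the variables of the proof tree; its root
      -- and hypotheses are closed and do not change.
      have h := (Der.of_provable (D := fun s b => ¬ ∃ q, K s b q) (ρ := fun _ => p) hstd ?_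
        hprov).1 _ _ _ rfl
      · rwa [show p.1.eval (fun _ => p) = p from Subtype.ext (Term.eval_of_isClosed _ p.2),
          show t'.eval (fun _ => p) = ⟨t', hγ.2⟩ from
            Subtype.ext (Term.eval_of_isClosed _ hγ.2)] at h
      · intro ν hν
        obtain ⟨⟨s, b, rfl⟩, hs⟩ := hN ν hν
        refine ⟨s, b, rfl, ?_⟩
        rintro ⟨q, hq⟩
        refine hcon _ ⟨_, _, _, hq, rfl⟩ _ hν ?_
        rw [Term.eval_of_isClosed _ hs]
        exact .pos_neg _ _ _

theorem step_iff_der (hstd : P.IsStandard) {p : ClosedTerm S V} {a : A} {q : ClosedTerm S V} :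
    P.Step p a q ↔ P.Der P.Refuses p a q := by
  constructor
  · exact (wsInduction (MP := P.Der P.Refuses) (MN := P.Refuses) hstd
      (fun r σ s a u hr hc => Der.rule r σ s a u hr hc)
      fun p a K hK hd => .of_not_der hstd K (fun p b q h => (hK p b q h).1) hd).1 p a q
  · intro h
    induction h with
    | rule r σ s a u hr hc _ hn ih => exact .of_rule hr hc ih hn

/-- Enlarging `K` only leaves fewer negative literals to derive from, so the set of all provable
transitions is the best choice of `K`. -/
theorem refuses_iff (hstd : P.IsStandard) {p : ClosedTerm S V} {a : A} :
    P.Refuses p a ↔ ∀ q, ¬ P.Der (fun s b => ¬ ∃ q, P.Step s b q) p a q := by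
  constructor
  · refine (wsInduction (MP := fun _ _ _ => True)
      (MN := fun p a => ∀ q, ¬ P.Der (fun s b => ¬ ∃ q, P.Step s b q) p a q) hstd
      (fun _ _ _ _ _ _ _ _ _ => trivial) fun p a K hK hd q hq => ?_).2 p a
    exact hd q (hq.mono fun s b h ⟨q, hq⟩ => h ⟨q, (hK _ _ _ hq).1⟩)
  · exact .of_not_der hstd _ fun _ _ _ h => h

end TSS

end WellSupported

/-! ### What the format says about rule instances. -/

section Format

variable {S : Signature.{u}} {V W : Type v} {A : Type w} {P : TSS S V A}
  {Λ : (f : S.Sym) → Fin (S.ar f) → Prop} {r : TransRule S V A}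

namespace TransRule

theorem occAt_source_unique (hr : r.IsNtyft ∨ r.IsNtyxt) {z : V} {p q : List ℕ}
    (hp : r.source.OccAt z p) (hq : r.source.OccAt z q) : p = q := by
  rcases hr with ⟨-, f, x, hx, hs⟩ | ⟨-, x, hs⟩
  · rw [hs] at hp hq
    cases hp with
    | arg _ _ i _ hi =>
      cases hq with
      | arg _ _ j _ hj =>
        obtain ⟨rfl, rfl⟩ := Term.occAt_var hi
        obtain ⟨h, rfl⟩ := Term.occAt_var hj
        rw [hx h]
  · rw [hs] at hp hq
    cases hp
    cases hq
    rfl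

/-- The source of a rule that has an instance `f(p₁,…,pₙ)` matches every term
`f(t₁,…,tₙ)` that evaluates to it. -/
theorem exists_bind_source_eq (hr : r.IsNtyft ∨ r.IsNtyxt) {f : S.Sym}
    {ts : Fin (S.ar f) → Term S W} {ρ : W → ClosedTerm S V} {σ : V → ClosedTerm S V}
    (h : r.source.eval σ = (Term.app f ts).eval ρ) :
    ∃ κ : V → Term S W, r.source.bind κ = Term.app f ts := by
  classical
  rcases hr with ⟨-, g, x, hx, hs⟩ | ⟨-, x, hs⟩
  · rw [hs] at h ⊢
    have h' := congrArg Subtype.val h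
    simp only [Term.eval, ClosedTerm.app, Term.app.injEq] at h'
    obtain ⟨rfl, -⟩ := h'
    -- Variables outside the source get a dummy value.
    refine ⟨fun z => if h : ∃ i, x i = z then ts h.choose else Term.app g ts, ?_⟩
    simp only [Term.bind]
    congr 1
    funext i
    have hi : ∃ j, x j = x i := ⟨i, rfl⟩
    rw [dif_pos hi, hx hi.choose_spec]
  · exact ⟨fun _ => Term.app f ts, by rw [hs]; rfl⟩

/-- The substitution that maps the variables of the source of `r` according to `κ`. -/
noncomputable abbrev lift (r : TransRule S V A) (κ : V → Term S W) : V → Term S (W ⊕ V) :=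
  Term.lift r.source.vars κ

theorem eval_lift {κ : V → Term S W} {ρ : W → ClosedTerm S V} {σ : V → ClosedTerm S V}
    (h : r.source.eval σ = (r.source.bind κ).eval ρ) (z : V) :
    (r.lift κ z).eval (Sum.elim ρ σ) = σ z := by
  by_cases hz : z ∈ r.source.vars
  · rw [Term.eval_lift_of_mem hz]
    rw [Term.eval_bind] at h
    exact (Term.eq_of_eval_eq h z hz).symm
  · exact Term.eval_lift_of_notMem hz _ _

theorem eval_bind_lift {κ : V → Term S W} {ρ : W → ClosedTerm S V} {σ : V → ClosedTerm S V}
    (h : r.source.eval σ = (r.source.bind κ).eval ρ) (s : Term S V) :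
    (s.bind (r.lift κ)).eval (Sum.elim ρ σ) = s.eval σ := by
  rw [Term.eval_bind]
  exact Term.eval_congr fun z _ => eval_lift h z

theorem eval_source_lift (κ : V → Term S W) (ρ : W → ClosedTerm S V) (σ : V → ClosedTerm S V) :
    r.source.eval (fun z => (r.lift κ z).eval (Sum.elim ρ σ)) = (r.source.bind κ).eval ρ := by
  rw [Term.eval_bind]
  exact Term.eval_congr fun z hz => Term.eval_lift_of_mem hz _ _

/-- Instances of a rule are obtained from instances of its premises. -/
theorem exists_der (hr : r ∈ P.rules) (hn : r.IsNtytt) (hl : r.NoLookahead)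
    {D : ClosedTerm S V → A → Prop} {s u : Term S V} {a : A} (hc : r.concl = .pos s a u)
    {κ : V → Term S W} {ρ : W → ClosedTerm S V} {σ : V → ClosedTerm S V}
    {R : V → ClosedTerm S V → Prop}
    (hpos : ∀ t b y, Literal.pos t b (.var y) ∈ r.prem → ∃ q,
      P.Der D ((t.bind (r.lift κ)).eval (Sum.elim ρ σ)) b q ∧ R y q)
    (hneg : ∀ t b, Literal.neg t b ∈ r.prem → D ((t.bind (r.lift κ)).eval (Sum.elim ρ σ)) b) :
    ∃ σ' : V → ClosedTerm S V, (∀ y, r.IsPremRhs y → R y (σ' y)) ∧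
      (∀ z, ¬ r.IsPremRhs z → σ' z = σ z) ∧
      P.Der D ((r.source.bind κ).eval ρ) a ((u.bind (r.lift κ)).eval (Sum.elim ρ σ')) := by
  -- Since each `y` is the right-hand side of at most one premise, its new value can be chosen
  -- independently of the others.
  have hex : ∀ y, ∃ q, (∀ t b, Literal.pos t b (.var y) ∈ r.prem →
      P.Der D ((t.bind (r.lift κ)).eval (Sum.elim ρ σ)) b q ∧ R y q) ∧
      (¬ r.IsPremRhs y → q = σ y) := by
    intro y
    by_cases hy : r.IsPremRhs y
    · obtain ⟨t, b, ht⟩ := hy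
      obtain ⟨q, hq⟩ := hpos t b y ht
      refine ⟨q, fun t' b' ht' => ?_, fun h => absurd ⟨t, b, ht⟩ h⟩
      obtain ⟨rfl, rfl⟩ := hn.distinct _ _ _ _ _ ht ht'
      exact hq
    · exact ⟨σ y, fun t b ht => absurd ⟨t, b, ht⟩ hy, fun _ => rfl⟩
  choose σ' h₁ h₂ using hex
  refine ⟨σ', fun y ⟨t, b, ht⟩ => (h₁ y t b ht).2, h₂, ?_⟩
  have hs : s = r.source := by rw [source, hc]; rfl
  have hlhs : ∀ l ∈ r.prem, l.lhs.eval (fun z => (r.lift κ z).eval (Sum.elim ρ σ')) =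
      (l.lhs.bind (r.lift κ)).eval (Sum.elim ρ σ) := by
    intro l hlp
    rw [Term.eval_bind]
    refine Term.eval_congr fun z hz => ?_
    by_cases hzs : z ∈ r.source.vars
    · rw [Term.eval_lift_of_mem hzs, Term.eval_lift_of_mem hzs]
    · rw [Term.eval_lift_of_notMem hzs, Term.eval_lift_of_notMem hzs]
      -- Without lookahead, revaluing the right-hand sides of premises leaves all left-hand sides
      -- unchanged.
      refine h₂ z fun ⟨t, b, ht⟩ => hl _ _ _ ht z rfl l hlp hz
  have := TSS.Der.rule (D := D) r (fun z => (r.lift κ z).eval (Sum.elim ρ σ')) s a u hr hc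
    (fun t b t' ht => ?_) fun t b ht => ?_
  · rwa [hs, eval_source_lift, ← Term.eval_bind] at this
  · obtain ⟨y, rfl, hy⟩ := hn.rhs_var _ _ _ ht
    rw [show t.eval _ = _ from hlhs _ ht]
    simp only [Term.eval]
    rw [Term.eval_lift_of_notMem hy]
    exact (h₁ y t b ht).1
  · rw [show t.eval _ = _ from hlhs _ ht]
    exact hneg t b ht

/-- A source variable whose substitute contains a variable from `X` is floating. -/
theorem floating_of_occAt (hr : r.IsNtyft ∨ r.IsNtyxt) {κ : V → Term S W} {X : Set W}
    (hX : (r.source.bind κ).LiquidIn Λ X) {x : W} (hx : x ∈ X) {z : V} (hz : z ∈ r.source.vars)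
    {p : List ℕ} (hp : (κ z).OccAt x p) : r.Floating Λ z ∧ (κ z).LiquidAt Λ x p := by
  obtain ⟨q, hq⟩ := Term.mem_vars_iff.1 hz
  have h := Term.LiquidAt.split hq (hX x hx _ (hq.bind hp))
  exact ⟨Or.inr ⟨q, h.1, fun q' hq' => occAt_source_unique hr hq' hq⟩, h.2⟩

theorem eq_of_occAt {κ : V → Term S W} {X : Set W} (hX : (r.source.bind κ).LinearIn X) {x : W}
    (hx : x ∈ X) {z z' : V} (hz : z ∈ r.source.vars) (hz' : z' ∈ r.source.vars) {p p' : List ℕ}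
    (hp : (κ z).OccAt x p) (hp' : (κ z').OccAt x p') : z = z' ∧ p = p' := by
  obtain ⟨q, hq⟩ := Term.mem_vars_iff.1 hz
  obtain ⟨q', hq'⟩ := Term.mem_vars_iff.1 hz'
  have h := hq.eq_of_append_eq hq' (hX x hx _ _ (hq.bind hp) (hq'.bind hp'))
  exact ⟨h.1, h.2.2⟩

theorem premise_place {l : Literal S V A} (hl : l ∈ r.prem) {x : V} {p : List ℕ}
    (h : l.lhs.OccAt x p) : r.Propagated x (.premLhs l p) ∨ r.Polled x (.premLhs l p) := by
  by_cases ht : r.RhsInTarget l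
  · exact Or.inl (.premLhs l p hl ht h)
  · exact Or.inr (.premLhs l p hl ht h)

theorem FailureTraceSafe.liquidAt_premise (hs : r.FailureTraceSafe Λ) {z : V}
    (hz : r.Floating Λ z) {l : Literal S V A} (hl : l ∈ r.prem) {p : List ℕ}
    (h : l.lhs.OccAt z p) : l.lhs.LiquidAt Λ z p := by
  rcases premise_place hl h with h' | h'
  · exact hs.propagated_liquid z hz _ h'
  · exact hs.polled_liquid z hz _ h'

/-- A negative premise has no right-hand side, so occurrences in it are polled, and polled floating
variables must be in positive premises. -/
theorem FailureTraceSafe.not_occAt_neg (hs : r.FailureTraceSafe Λ) {z : V}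
    (hz : r.Floating Λ z) {t : Term S V} {b : A} (hl : Literal.neg t b ∈ r.prem) {p : List ℕ}
    (h : t.OccAt z p) : False := by
  rcases premise_place (x := z) (p := p) hl h with h' | h'
  · cases h' with
    | premLhs _ _ _ ht _ =>
      obtain ⟨y, hy, -⟩ := ht
      cases hy
  · obtain ⟨_, _, _, h⟩ := hs.polled_pos z hz _ h'
    cases h

theorem FailureTraceSafe.place_unique (hs : r.FailureTraceSafe Λ) {z : V}
    (hz : r.Floating Λ z) {o o' : Place S V A} (h : r.Propagated z o ∨ r.Polled z o)
    (h' : r.Propagated z o' ∨ r.Polled z o') : o = o' := by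
  rcases h with h | h <;> rcases h' with h' | h'
  · exact hs.propagated_once z hz _ _ h h'
  · exact absurd ⟨⟨_, h⟩, _, h'⟩ (hs.not_both z hz)
  · exact absurd ⟨⟨_, h'⟩, _, h⟩ (hs.not_both z hz)
  · exact hs.polled_once z hz _ _ h h'

/-- The variables from `X` stay at liquid positions in the premises. -/
theorem FailureTraceSafe.liquidIn_premise (hs : r.FailureTraceSafe Λ)
    (hr : r.IsNtyft ∨ r.IsNtyxt) {κ : V → Term S W} {X : Set W}
    (hX : (r.source.bind κ).LiquidIn Λ X) {l : Literal S V A} (hl : l ∈ r.prem) :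
    (l.lhs.bind (r.lift κ)).LiquidIn Λ (Sum.inl '' X) := by
  rintro _ ⟨x, hx, rfl⟩ p hp
  obtain ⟨z, p₁, p₂, hz, h₁, h₂, rfl⟩ := Term.occAt_bind_lift_inl hp
  obtain ⟨hf, h₃⟩ := floating_of_occAt hr hX hx hz h₂
  exact (hs.liquidAt_premise hf hl h₁).bind (.lift hz h₃)

/-- No variable from `X` enters a negative premise. -/
theorem FailureTraceSafe.notMem_neg_premise (hs : r.FailureTraceSafe Λ)
    (hr : r.IsNtyft ∨ r.IsNtyxt) {κ : V → Term S W} {X : Set W}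
    (hX : (r.source.bind κ).LiquidIn Λ X) {t : Term S V} {b : A} (hl : Literal.neg t b ∈ r.prem)
    {x : W} (hx : x ∈ X) : Sum.inl x ∉ (t.bind (r.lift κ)).vars := by
  intro h
  obtain ⟨p, hp⟩ := Term.mem_vars_iff.1 h
  obtain ⟨z, p₁, p₂, hz, h₁, h₂, rfl⟩ := Term.occAt_bind_lift_inl hp
  exact hs.not_occAt_neg (floating_of_occAt hr hX hx hz h₂).1 hl h₁

/-- By linearity of the instantiated source, `x` stems from a single source variable. That variable
is floating and so has only one place in the rule. -/
theorem FailureTraceSafe.linearIn_premise (hs : r.FailureTraceSafe Λ)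
    (hr : r.IsNtyft ∨ r.IsNtyxt) {κ : V → Term S W} {X : Set W}
    (hX : (r.source.bind κ).LiquidIn Λ X) (hX' : (r.source.bind κ).LinearIn X)
    {l : Literal S V A} (hl : l ∈ r.prem) :
    (l.lhs.bind (r.lift κ)).LinearIn (Sum.inl '' X) := by
  rintro _ ⟨x, hx, rfl⟩ p q hp hq
  obtain ⟨z, p₁, p₂, hz, h₁, h₂, rfl⟩ := Term.occAt_bind_lift_inl hp
  obtain ⟨z', q₁, q₂, hz', h₃, h₄, rfl⟩ := Term.occAt_bind_lift_inl hq
  obtain ⟨rfl, rfl⟩ := eq_of_occAt hX' hx hz hz' h₂ h₄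
  have := hs.place_unique (floating_of_occAt hr hX hx hz h₂).1 (premise_place hl h₁)
    (premise_place hl h₃)
  rw [(Place.premLhs.inj this).2]

theorem mem_vars_of_mem_bind_lift {κ : V → Term S W} {s : Term S V} {x : W}
    (h : Sum.inl x ∈ (s.bind (r.lift κ)).vars) : x ∈ (r.source.bind κ).vars := by
  obtain ⟨p, hp⟩ := Term.mem_vars_iff.1 h
  obtain ⟨z, p₁, p₂, hz, h₁, h₂, rfl⟩ := Term.occAt_bind_lift_inl hp
  obtain ⟨q, hq⟩ := Term.mem_vars_iff.1 hz
  exact (hq.bind h₂).mem_vars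

/-- The variables that may be tested in the target: those from `X`, and the right-hand sides of
premises. -/
def targetVars (r : TransRule S V A) (X : Set W) : Set (W ⊕ V) :=
  Sum.elim (· ∈ X) r.IsPremRhs

theorem FailureTraceSafe.liquidIn_target (hs : r.FailureTraceSafe Λ)
    (hr : r.IsNtyft ∨ r.IsNtyxt) {κ : V → Term S W} {X : Set W}
    (hX : (r.source.bind κ).LiquidIn Λ X) {s u : Term S V} {a : A} (hc : r.concl = .pos s a u) :
    (u.bind (r.lift κ)).LiquidIn Λ (r.targetVars X) := by
  have key : ∀ z p, r.Floating Λ z → u.OccAt z p → u.LiquidAt Λ z p := by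
    intro z p hz hp
    obtain ⟨u', hu', h⟩ := hs.propagated_liquid z hz (.target p) (.target u p (by rw [hc]; rfl) hp)
    rw [hc] at hu'
    cases hu'
    exact h
  rintro (x | y) hx p hp
  · obtain ⟨z, p₁, p₂, hz, h₁, h₂, rfl⟩ := Term.occAt_bind_lift_inl hp
    obtain ⟨hf, h₃⟩ := floating_of_occAt hr hX hx hz h₂
    exact (key z p₁ hf h₁).bind (.lift hz h₃)
  · obtain ⟨hy, h⟩ := Term.occAt_bind_lift_inr hp
    rw [← List.append_nil p]
    refine (key y p (Or.inl hx) h).bind ?_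
    rw [lift, Term.lift, if_neg hy]
    exact .here

theorem FailureTraceSafe.linearIn_target (hs : r.FailureTraceSafe Λ)
    (hr : r.IsNtyft ∨ r.IsNtyxt) {κ : V → Term S W} {X : Set W}
    (hX : (r.source.bind κ).LiquidIn Λ X) (hX' : (r.source.bind κ).LinearIn X)
    {s u : Term S V} {a : A} (hc : r.concl = .pos s a u) :
    (u.bind (r.lift κ)).LinearIn (r.targetVars X) := by
  have key : ∀ z p q, r.Floating Λ z → u.OccAt z p → u.OccAt z q → p = q := by
    intro z p q hz hp hq
    have hu : u ∈ r.concl.rhs := by rw [hc]; rfl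
    exact Place.target.inj (hs.propagated_once z hz _ _ (.target u p hu hp) (.target u q hu hq))
  rintro (x | y) hx p q hp hq
  · obtain ⟨z, p₁, p₂, hz, h₁, h₂, rfl⟩ := Term.occAt_bind_lift_inl hp
    obtain ⟨z', q₁, q₂, hz', h₃, h₄, rfl⟩ := Term.occAt_bind_lift_inl hq
    obtain ⟨rfl, rfl⟩ := eq_of_occAt hX' hx hz hz' h₂ h₄
    rw [key z p₁ q₁ (floating_of_occAt hr hX hx hz h₂).1 h₁ h₃]
  · exact key y p q (Or.inl hx) (Term.occAt_bind_lift_inr hp).2 (Term.occAt_bind_lift_inr hq).2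

end TransRule

namespace TSS

/-- Every action refused by `p` is refused by `q`. -/
def RefLE (P : TSS S V A) (p q : ClosedTerm S V) : Prop := ∀ a, P.Refuses p a → P.Refuses q a

/-- Inclusion of refusals and of initial actions. -/
def InitLE (P : TSS S V A) (p q : ClosedTerm S V) : Prop :=
  P.RefLE p q ∧ ∀ a, (∃ p', P.Step p a p') → ∃ q', P.Step q a q'

theorem InitLE.refl (p : ClosedTerm S V) : P.InitLE p p := ⟨fun _ h => h, fun _ h => h⟩

end TSS
end Format

/-! ### Preservation of refusals and initial actions. -/

section Transfer

variable {S : Signature.{u}} {V : Type v} {A : Type w} {P : TSS S V A}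
  {Λ : (f : S.Sym) → Fin (S.ar f) → Prop}

namespace TSS

/-- Initial actions and refusals of `t` are preserved when the variables of `t` are replaced by
processes with at least the same initial actions and refusals; in the case of refusals, variables
at liquid positions only need to preserve refusals. -/
theorem transfer (hstd : P.IsStandard) (hf : P.InNtyftNtyxtFormat)
    (hΛ : ∀ r ∈ P.rules, r.FailureTraceSafe Λ) :
    (∀ p a q, P.Step p a q → P.Step p a q ∧ ∀ (W : Type v) (t : Term S W)
      (ρ ρ' : W → ClosedTerm S V), t.eval ρ = p → (∀ w ∈ t.vars, P.InitLE (ρ w) (ρ' w)) →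
        ∃ q', P.Step (t.eval ρ') a q') ∧
    (∀ p a, P.Refuses p a → P.Refuses p a ∧ ∀ (W : Type v) (t : Term S W) (X : Set W)
      (ρ ρ' : W → ClosedTerm S V), t.LiquidIn Λ X → t.eval ρ = p →
        (∀ w ∈ t.vars, P.RefLE (ρ w) (ρ' w)) →
        (∀ w ∈ t.vars, w ∉ X → P.InitLE (ρ w) (ρ' w)) → P.Refuses (t.eval ρ') a) := by
  refine wsInduction hstd ?_ ?_
  · intro r σ s a u hr hc hp hn
    have hstep := Step.of_rule hr hc (fun t b t' ht => (hp t b t' ht).1)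
      fun t b ht => (hn t b ht).1
    refine ⟨hstep, fun W t ρ ρ' ht hρ => ?_⟩
    cases t with
    | var w =>
      rw [← ht] at hstep
      exact (hρ w rfl).2 a ⟨_, hstep⟩
    | app f ts =>
      have hsrc : r.source.eval σ = (Term.app f ts).eval ρ := by
        rw [ht, TransRule.source, hc]; rfl
      obtain ⟨κ, hκ⟩ := TransRule.exists_bind_source_eq (hf r hr) hsrc
      rw [← hκ] at hsrc hρ ⊢
      have hρ' : ∀ t : Term S V, ∀ w ∈ (t.bind (r.lift κ)).vars,
          P.InitLE (Sum.elim ρ σ w) (Sum.elim ρ' σ w) := by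
        rintro t (w | z) hw
        · exact hρ w (TransRule.mem_vars_of_mem_bind_lift hw)
        · exact .refl _
      obtain ⟨σ', -, -, h⟩ := TransRule.exists_der (D := P.Refuses) hr
        ((hf r hr).elim And.left And.left) (hΛ r hr).no_lookahead hc (κ := κ) (ρ := ρ') (σ := σ)
        (R := fun _ _ => True)
        (fun t b y ht => by
          obtain ⟨q, hq⟩ := (hp t b _ ht).2 _ _ _ _ (TransRule.eval_bind_lift hsrc t) (hρ' t)
          exact ⟨q, (step_iff_der hstd).1 hq, trivial⟩)
        (fun t b ht => (hn t b ht).2 _ _ ∅ _ _ (fun _ h => h.elim)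
          (TransRule.eval_bind_lift hsrc t) (fun w hw => (hρ' t w hw).1) fun w hw _ => hρ' t w hw)
      exact ⟨_, (step_iff_der hstd).2 h⟩
  · intro p a K hK hd
    refine ⟨.of_not_der hstd K (fun p b q h => (hK p b q h).1) hd, ?_⟩
    intro W t X ρ ρ' hX ht hρ hρX
    rw [refuses_iff hstd]
    intro q hq
    -- A derivation for the `ρ'`-instance is pulled back to one for the `ρ`-instance, with negative
    -- premises judged by the given `K`. This contradicts `hd`.
    have key : ∀ p' a q', P.Der (fun s b => ¬ ∃ q, P.Step s b q) p' a q' →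
        P.Der (fun s b => ¬ ∃ q, P.Step s b q) p' a q' ∧
        ∀ (W : Type v) (t : Term S W) (X : Set W) (ρ ρ' : W → ClosedTerm S V), t.LiquidIn Λ X →
          t.eval ρ' = p' → (∀ w ∈ t.vars, P.RefLE (ρ w) (ρ' w)) →
          (∀ w ∈ t.vars, w ∉ X → P.InitLE (ρ w) (ρ' w)) →
          ∃ q, P.Der (fun s b => ¬ ∃ q, K s b q) (t.eval ρ) a q := by
      intro p' a' q' h
      induction h with
      | rule r σ s a u hr hc hp hn ih =>
        have hstep := Der.rule r σ s a u hr hc hp hn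
        refine ⟨hstep, fun W t X ρ ρ' hX ht hρ hρX => ?_⟩
        cases t with
        | var w =>
          rw [← ht] at hstep
          by_contra hcon
          -- If `ρ w` had no such derivation it would refuse `a`; then so would `ρ' w`, although a
          -- transition is derivable for it.
          have := hρ w rfl a ((refuses_iff hstd).2 fun q hq => hcon ⟨q,
            hq.mono fun s b h ⟨q, hq⟩ => h ⟨q, (hK _ _ _ hq).1⟩⟩)
          exact (refuses_iff hstd).1 this _ hstep
        | app f ts =>
          have hsrc : r.source.eval σ = (Term.app f ts).eval ρ' := by
            rw [ht, TransRule.source, hc]; rfl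
          obtain ⟨κ, hκ⟩ := TransRule.exists_bind_source_eq (hf r hr) hsrc
          rw [← hκ] at hsrc hρ hρX hX ⊢
          have hex := TransRule.exists_der (D := fun s b => ¬ ∃ q, K s b q) hr
            ((hf r hr).elim And.left And.left) (hΛ r hr).no_lookahead hc (κ := κ) (ρ := ρ) (σ := σ)
            (R := fun _ _ => True) (fun t b y ht => ?_) (fun t b ht => ?_)
          · obtain ⟨σ', -, -, h⟩ := hex
            exact ⟨_, h⟩
          · have hex := (ih t b _ ht).2 _ _ _ (Sum.elim ρ σ) (Sum.elim ρ' σ)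
              ((hΛ r hr).liquidIn_premise (hf r hr) hX ht) (TransRule.eval_bind_lift hsrc t) ?_ ?_
            · obtain ⟨q, hq⟩ := hex
              exact ⟨q, hq, trivial⟩
            · rintro (w | z) hw
              · exact hρ w (TransRule.mem_vars_of_mem_bind_lift hw)
              · exact (InitLE.refl _).1
            · rintro (w | z) hw hwX
              · exact hρX w (TransRule.mem_vars_of_mem_bind_lift hw)
                  fun h => hwX ⟨w, h, rfl⟩
              · exact .refl _
          · rintro ⟨q, hq⟩
            -- A transition in `K` denying this premise would carry forward to the `ρ'`-instance,
            -- where the premise is undenied. Preservation of initial actions is available because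
            -- no variable of `X` enters a negative premise.
            obtain ⟨q', hq'⟩ := (hK _ _ _ hq).2.2 _ (t.bind (r.lift κ)) (Sum.elim ρ σ)
              (Sum.elim ρ' σ) rfl (by
                rintro (w | z) hw
                · exact hρX w (TransRule.mem_vars_of_mem_bind_lift hw) fun h =>
                    (hΛ r hr).notMem_neg_premise (hf r hr) hX ht h hw
                · exact .refl _)
            rw [TransRule.eval_bind_lift hsrc] at hq'
            exact hn t b ht ⟨_, hq'⟩
    obtain ⟨q', hq'⟩ := (key _ _ _ hq).2 W t X ρ ρ' hX rfl hρ hρX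
    rw [ht] at hq'
    exact hd q' hq'

theorem Refuses.transfer (hstd : P.IsStandard) (hf : P.InNtyftNtyxtFormat)
    (hΛ : ∀ r ∈ P.rules, r.FailureTraceSafe Λ) {W : Type v} {t : Term S W} {X : Set W}
    {ρ ρ' : W → ClosedTerm S V} {a : A} (h : P.Refuses (t.eval ρ) a) (hX : t.LiquidIn Λ X)
    (hρ : ∀ w ∈ t.vars, P.RefLE (ρ w) (ρ' w))
    (hρX : ∀ w ∈ t.vars, w ∉ X → P.InitLE (ρ w) (ρ' w)) : P.Refuses (t.eval ρ') a :=
  ((TSS.transfer hstd hf hΛ).2 _ _ h).2 W t X ρ ρ' hX rfl hρ hρX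

end TSS
end Transfer

/-! ### Decomposition of observations and the precongruence results. -/

section Decomposition

variable {S : Signature.{u}} {V : Type v} {A : Type w} {P : TSS S V A}
  {Λ : (f : S.Sym) → Fin (S.ar f) → Prop} {ft : Prop}

namespace TSS

/-- `P.Observable ft n Q`: the set `Q` of closed terms is the extension of a failure observation
(a failure trace observation, if `ft` holds) with at most `n` nested actions. -/
inductive Observable (P : TSS S V A) (ft : Prop) : ℕ → Set (ClosedTerm S V) → Prop
  | top (n : ℕ) : Observable P ft n Set.univ
  | act (n : ℕ) (a : A) (Q : Set (ClosedTerm S V)) : Observable P ft n Q →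
      Observable P ft (n + 1) {p | ∃ q, P.Step p a q ∧ q ∈ Q}
  | refusals (n : ℕ) (B : Set A) : Observable P ft n {p | ∀ b ∈ B, P.Refuses p b}
  | refusalTrace (n : ℕ) (B : Set A) (Q : Set (ClosedTerm S V)) : ft → Observable P ft n Q →
      Observable P ft n {p | (∀ b ∈ B, P.Refuses p b) ∧ p ∈ Q}

/-- Needed because the target yields observations of level `n` and the premises ones of level `n +
1`, and both are demands on the same variables. -/
theorem Observable.succ {n : ℕ} {Q : Set (ClosedTerm S V)} (h : P.Observable ft n Q) :
    P.Observable ft (n + 1) Q := by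
  induction h with
  | top n => exact .top _
  | act n a Q _ ih => exact .act _ a Q ih
  | refusals n B => exact .refusals _ B
  | refusalTrace n B Q h _ ih => exact .refusalTrace _ B Q h ih

/-- Inclusion of observations. -/
def ObsLE (P : TSS S V A) (ft : Prop) (p q : ClosedTerm S V) : Prop :=
  ∀ n Q, P.Observable ft n Q → p ∈ Q → q ∈ Q

theorem ObsLE.initLE {p q : ClosedTerm S V} (h : P.ObsLE ft p q) : P.InitLE p q := by
  refine ⟨fun a ha => ?_, fun a ⟨p', hp'⟩ => ?_⟩
  · exact h 0 _ (.refusals 0 {a}) (by rintro _ rfl; exact ha) a rfl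
  · obtain ⟨q', hq', -⟩ := h 1 _ (.act 0 a _ (.top 0)) ⟨p', hp', trivial⟩
    exact ⟨q', hq'⟩

/-- For every term `t` in which the variables from `X` occur at most once, at liquid positions,
an observation of level `n` of an instance of `t` in `Q` is implied by observations of level `n` of
the processes substituted for the variables from `X`. -/
def Decomposes (P : TSS S V A) (Λ : (f : S.Sym) → Fin (S.ar f) → Prop) (ft : Prop) (n : ℕ)
    (p : ClosedTerm S V) (Q : Set (ClosedTerm S V)) : Prop :=
  ∀ (W : Type v) (t : Term S W) (X : Set W) (ρ : W → ClosedTerm S V),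
    t.LiquidIn Λ X → t.LinearIn X → t.eval ρ = p →
    ∃ ψ : W → Set (ClosedTerm S V), (∀ x, P.Observable ft n (ψ x) ∧ ρ x ∈ ψ x) ∧
      ∀ ρ' : W → ClosedTerm S V, (∀ x ∈ X, x ∈ t.vars → ρ' x ∈ ψ x) →
        (∀ y ∈ t.vars, y ∉ X → P.ObsLE ft (ρ y) (ρ' y)) → t.eval ρ' ∈ Q

/-- The observation of `p` that consists of all its refusals. -/
def refusalSet (P : TSS S V A) (p : ClosedTerm S V) : Set (ClosedTerm S V) :=
  {q | ∀ b ∈ {b | P.Refuses p b}, P.Refuses q b}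

theorem Refuses.transfer_of_mem_refusalSet (hstd : P.IsStandard) (hf : P.InNtyftNtyxtFormat)
    (hΛ : ∀ r ∈ P.rules, r.FailureTraceSafe Λ) {W : Type v} {t : Term S W} {X : Set W}
    {ρ ρ' : W → ClosedTerm S V} {a : A} (h : P.Refuses (t.eval ρ) a) (hX : t.LiquidIn Λ X)
    (hρ : ∀ x ∈ X, x ∈ t.vars → ρ' x ∈ P.refusalSet (ρ x))
    (hρX : ∀ y ∈ t.vars, y ∉ X → P.ObsLE ft (ρ y) (ρ' y)) : P.Refuses (t.eval ρ') a := by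
  refine h.transfer hstd hf hΛ hX (fun w hw => ?_) fun w hw hwX => (hρX w hw hwX).initLE
  by_cases hwX : w ∈ X
  · exact hρ w hwX hw
  · exact (hρX w hw hwX).initLE.1

/-- The observations for the target and the premises combine, since every variable from `X`
occurs in at most one of them. -/
theorem exists_combined_observable {W : Type v} {r : TransRule S V A} (hs : r.FailureTraceSafe Λ)
    (hr : r.IsNtyft ∨ r.IsNtyxt) {κ : V → Term S W} {X : Set W}
    (hX : (r.source.bind κ).LiquidIn Λ X) (hX' : (r.source.bind κ).LinearIn X)
    {s u : Term S V} {a : A} (hc : r.concl = .pos s a u) {n : ℕ} {p : ClosedTerm S V} {x : W}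
    (hx : x ∈ X) {φ : Set (ClosedTerm S V)} (hφ : P.Observable ft n φ ∧ p ∈ φ)
    {χ : (l : Literal S V A) → l ∈ r.prem → Set (ClosedTerm S V)}
    (hχ : ∀ l hl, P.Observable ft n (χ l hl) ∧ p ∈ χ l hl) :
    ∃ ψ : Set (ClosedTerm S V), (P.Observable ft n ψ ∧ p ∈ ψ) ∧
      (Sum.inl x ∈ (u.bind (r.lift κ)).vars → ψ ⊆ φ) ∧
      ∀ l hl, Sum.inl x ∈ (l.lhs.bind (r.lift κ)).vars → ψ ⊆ χ l hl := by
  by_cases h : ∃ l, l ∈ r.prem ∧ Sum.inl x ∈ (l.lhs.bind (r.lift κ)).vars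
  · obtain ⟨l, hl, h⟩ := h
    obtain ⟨p, hp⟩ := Term.mem_vars_iff.1 h
    obtain ⟨z, p₁, p₂, hz, h₁, h₂, rfl⟩ := Term.occAt_bind_lift_inl hp
    have hfl := (TransRule.floating_of_occAt hr hX hx hz h₂).1
    have hpl := TransRule.premise_place hl h₁
    refine ⟨χ l hl, hχ l hl, fun h' => ?_, fun l' hl' h' => ?_⟩
    · obtain ⟨q, hq⟩ := Term.mem_vars_iff.1 h'
      obtain ⟨z', q₁, q₂, hz', h₃, h₄, rfl⟩ := Term.occAt_bind_lift_inl hq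
      obtain ⟨rfl, rfl⟩ := TransRule.eq_of_occAt hX' hx hz hz' h₂ h₄
      cases hs.place_unique hfl hpl (Or.inl (.target u q₁ (by rw [hc]; rfl) h₃))
    · obtain ⟨q, hq⟩ := Term.mem_vars_iff.1 h'
      obtain ⟨z', q₁, q₂, hz', h₃, h₄, rfl⟩ := Term.occAt_bind_lift_inl hq
      obtain ⟨rfl, rfl⟩ := TransRule.eq_of_occAt hX' hx hz hz' h₂ h₄
      cases hs.place_unique hfl hpl (TransRule.premise_place hl' h₃)
      exact subset_rfl
  · push Not at h
    exact ⟨φ, hφ, fun _ => subset_rfl, fun l hl h' => absurd h' (h l hl)⟩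

/-- Induction on the derivation at a fixed level. `Q` varies, since each premise is decomposed for
its own observation, the one that the target demands of its right-hand side. -/
theorem decomposes_act (hstd : P.IsStandard) (hf : P.InNtyftNtyxtFormat)
    (hΛ : ∀ r ∈ P.rules, r.FailureTraceSafe Λ) {n : ℕ}
    (hn : ∀ Q, P.Observable ft n Q → ∀ q ∈ Q, P.Decomposes Λ ft n q Q)
    {p : ClosedTerm S V} {a : A} {q : ClosedTerm S V} (h : P.Der P.Refuses p a q)
    {Q : Set (ClosedTerm S V)} (hQ : P.Observable ft n Q) (hq : q ∈ Q) :
    P.Decomposes Λ ft (n + 1) p {p | ∃ q, P.Step p a q ∧ q ∈ Q} := by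
  induction h generalizing Q with
  | rule r σ s a u hr hc hp hneg ih =>
    intro W t X ρ hX hX' ht
    have hstep := (step_iff_der hstd).2 (Der.rule r σ s a u hr hc hp hneg)
    cases t with
    | var w =>
      classical
      refine ⟨fun x => if x = w then {p | ∃ q, P.Step p a q ∧ q ∈ Q} else Set.univ,
        fun x => ?_, fun ρ' h₁ h₂ => ?_⟩
      · dsimp only
        split_ifs with h
        · subst h
          rw [← ht] at hstep
          exact ⟨.act n a Q hQ, _, hstep, hq⟩
        · exact ⟨.top _, trivial⟩
      · by_cases hw : w ∈ X
        · have := h₁ w hw rfl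
          dsimp only at this
          rwa [if_pos rfl] at this
        · rw [← ht] at hstep
          exact h₂ w rfl hw _ _ (.act n a Q hQ) ⟨_, hstep, hq⟩
    | app f ts =>
      have hsrc : r.source.eval σ = (Term.app f ts).eval ρ := by
        rw [ht, TransRule.source, hc]; rfl
      obtain ⟨κ, hκ⟩ := TransRule.exists_bind_source_eq (hf r hr) hsrc
      rw [← hκ] at hsrc hX hX' ⊢
      have hs := hΛ r hr
      -- `φ (Sum.inr y)` becomes the requirement on the premise with right-hand side `y`; `φ
      -- (Sum.inl x)` is the target's direct demand on `x`.
      obtain ⟨φ, hφ, hφ'⟩ := hn Q hQ _ hq _ (u.bind (r.lift κ)) (r.targetVars X) (Sum.elim ρ σ)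
        (hs.liquidIn_target (hf r hr) hX hc) (hs.linearIn_target (hf r hr) hX hX' hc)
        (TransRule.eval_bind_lift hsrc u)
      have hprem : ∀ l, l ∈ r.prem → ∃ χ : W ⊕ V → Set (ClosedTerm S V),
          (∀ x, P.Observable ft (n + 1) (χ x) ∧ Sum.elim ρ σ x ∈ χ x) ∧
          ∀ t b y, l = .pos t b (.var y) → ∀ ρ' : W → ClosedTerm S V,
            (∀ x ∈ X, Sum.inl x ∈ (t.bind (r.lift κ)).vars → ρ' x ∈ χ (Sum.inl x)) →
            (∀ x ∈ (r.source.bind κ).vars, x ∉ X → P.ObsLE ft (ρ x) (ρ' x)) →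
            ∃ q, P.Step ((t.bind (r.lift κ)).eval (Sum.elim ρ' σ)) b q ∧ q ∈ φ (Sum.inr y) := by
        rintro (⟨t, b, t'⟩ | ⟨t, b⟩) hl
        · obtain ⟨y, rfl, hy⟩ := ((hf r hr).elim And.left And.left).rhs_var _ _ _ hl
          obtain ⟨χ, hχ, hχ'⟩ := ih t b _ hl (hφ (Sum.inr y)).1 (hφ (Sum.inr y)).2 _
            (t.bind (r.lift κ)) (Sum.inl '' X) (Sum.elim ρ σ)
            (hs.liquidIn_premise (hf r hr) hX hl) (hs.linearIn_premise (hf r hr) hX hX' hl)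
            (TransRule.eval_bind_lift hsrc t)
          refine ⟨χ, hχ, fun t₁ b₁ y₁ he ρ' h₁ h₂ => ?_⟩
          cases he
          refine hχ' (Sum.elim ρ' σ) ?_ ?_
          · rintro _ ⟨x, hx, rfl⟩ hx'
            exact h₁ x hx hx'
          · rintro (x | z) hx hxX
            · exact h₂ x (TransRule.mem_vars_of_mem_bind_lift hx) fun h => hxX ⟨x, h, rfl⟩
            · exact fun _ _ _ h => h
        -- Negative premises make no demand on `X`; they are settled by transfer of refusals.
        · exact ⟨fun _ => Set.univ, fun _ => ⟨.top _, trivial⟩, fun _ _ _ h => by cases h⟩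
      choose χ hχ hχ' using hprem
      have hψ : ∀ x, ∃ ψ : Set (ClosedTerm S V), (P.Observable ft (n + 1) ψ ∧ ρ x ∈ ψ) ∧
          (x ∈ X → (Sum.inl x ∈ (u.bind (r.lift κ)).vars → ψ ⊆ φ (Sum.inl x)) ∧
            ∀ l hl, Sum.inl x ∈ (l.lhs.bind (r.lift κ)).vars → ψ ⊆ χ l hl (Sum.inl x)) := by
        intro x
        by_cases hx : x ∈ X
        · obtain ⟨ψ, h₁, h₂⟩ := exists_combined_observable hs (hf r hr) hX hX' hc hx
            ⟨(hφ (Sum.inl x)).1.succ, (hφ (Sum.inl x)).2⟩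
            (fun l hl => hχ l hl (Sum.inl x))
          exact ⟨ψ, h₁, fun _ => h₂⟩
        · exact ⟨Set.univ, ⟨.top _, trivial⟩, fun h => absurd h hx⟩
      choose ψ hψ hψ' using hψ
      refine ⟨ψ, hψ, fun ρ' h₁ h₂ => ?_⟩
      have hex := TransRule.exists_der (D := P.Refuses) hr
        ((hf r hr).elim And.left And.left) hs.no_lookahead hc (κ := κ) (ρ := ρ') (σ := σ)
        (R := fun y q => q ∈ φ (Sum.inr y)) (fun t b y ht => ?_) (fun t b ht => ?_)
      · obtain ⟨σ', hσ', hσ'', h⟩ := hex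
        refine ⟨_, (step_iff_der hstd).2 h, hφ' _ ?_ ?_⟩
        · rintro (x | y) hx hxu
          · exact (hψ' x hx).1 hxu (h₁ x hx (TransRule.mem_vars_of_mem_bind_lift hxu))
          · exact hσ' y hx
        · rintro (x | z) hxu hx
          · exact h₂ x (TransRule.mem_vars_of_mem_bind_lift hxu) hx
          · simp only [Sum.elim_inr, hσ'' z hx]
            exact fun _ _ _ h => h
      · obtain ⟨q, hq, hq'⟩ := hχ' _ ht t b y rfl ρ' (fun x hx hxt => (hψ' x hx).2 _ ht hxt
          (h₁ x hx (TransRule.mem_vars_of_mem_bind_lift hxt))) h₂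
        exact ⟨q, (step_iff_der hstd).1 hq, hq'⟩
      · have := hneg t b ht
        rw [← TransRule.eval_bind_lift hsrc t] at this
        refine this.transfer_of_mem_refusalSet (ft := ft) hstd hf hΛ
          (hs.liquidIn_premise (hf r hr) hX ht) ?_ ?_
        · rintro _ ⟨x, hx, rfl⟩ hxt
          exact absurd hxt (hs.notMem_neg_premise (hf r hr) hX ht hx)
        · rintro (x | z) hxt hx
          · exact h₂ x (TransRule.mem_vars_of_mem_bind_lift hxt) fun h => hx ⟨x, h, rfl⟩
          · exact fun _ _ _ h => h

theorem decomposes (hstd : P.IsStandard) (hf : P.InNtyftNtyxtFormat)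
    (hΛ : ∀ r ∈ P.rules, r.FailureTraceSafe Λ) (n : ℕ) :
    ∀ Q, P.Observable ft n Q → ∀ q ∈ Q, P.Decomposes Λ ft n q Q := by
  -- Two inductions: only an action lowers the level, while prefixing refusals keeps it and is
  -- handled by structural induction.
  have main : ∀ n Q, P.Observable ft n Q →
      (∀ m < n, ∀ Q, P.Observable ft m Q → ∀ q ∈ Q, P.Decomposes Λ ft m q Q) →
      ∀ q ∈ Q, P.Decomposes Λ ft n q Q := by
    intro n Q hQ
    induction hQ with
    | top n =>
      intro _ q _ W t X ρ _ _ _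
      exact ⟨fun _ => Set.univ, fun _ => ⟨.top _, trivial⟩, fun _ _ _ => trivial⟩
    | act n a Q hQ _ =>
      rintro hn q ⟨q', hq, hq'⟩
      exact decomposes_act hstd hf hΛ (hn n n.lt_succ_self) ((step_iff_der hstd).1 hq) hQ hq'
    | refusals n B =>
      rintro - q hq W t X ρ hX - rfl
      -- Whatever `B` is, each variable is asked for all refusals of its current value.
      exact ⟨fun x => P.refusalSet (ρ x), fun x => ⟨.refusals _ _, fun _ h => h⟩,
        fun ρ' h₁ h₂ b hb => (hq b hb).transfer_of_mem_refusalSet hstd hf hΛ hX h₁ h₂⟩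
    | refusalTrace n B Q hft _ ih =>
      rintro hn q ⟨hq, hq'⟩ W t X ρ hX hX' rfl
      obtain ⟨ψ, hψ, hψ'⟩ := ih hn _ hq' W t X ρ hX hX' rfl
      refine ⟨fun x => {q | q ∈ P.refusalSet (ρ x) ∧ q ∈ ψ x},
        fun x => ⟨.refusalTrace _ _ _ hft (hψ x).1, fun _ h => h, (hψ x).2⟩,
        fun ρ' h₁ h₂ => ⟨fun b hb => ?_, hψ' ρ' (fun x hx hxt => (h₁ x hx hxt).2) h₂⟩⟩
      exact (hq b hb).transfer_of_mem_refusalSet hstd hf hΛ hX (fun x hx hxt => (h₁ x hx hxt).1) h₂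
  induction n using Nat.strong_induction_on with
  | _ n ih => exact fun Q hQ => main n Q hQ ih

theorem isPrecongruence_obsLE (hstd : P.IsStandard) (hP : P.InFailureTraceFormat) (ft : Prop) :
    IsPrecongruence (P.ObsLE ft) where
  refl _ _ _ _ h := h
  trans _ _ _ h h' n Q hQ hp := h' n Q hQ (h n Q hQ hp)
  app f p q h n Q hQ hp := by
    obtain ⟨hf, Λ, hΛ⟩ := hP
    -- With `X = ∅` the observations `ψ` are irrelevant: every argument is related by the full
    -- preorder.
    obtain ⟨ψ, -, hψ⟩ := decomposes hstd hf hΛ n Q hQ _ hp (ULift.{v} (Fin (S.ar f)))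
      (.app f fun i => .var ⟨i⟩) ∅ (fun i => p i.down) (fun _ h => h.elim) (fun _ h => h.elim) rfl
    exact hψ (fun i => q i.down) (fun _ h => h.elim) fun y _ _ => h y.down

theorem sat_refusals {I : Type w} (a : I → A) :
    {p | P.Sat (Obs.conj fun i => Obs.refuse (a i)) p} =
      {p | ∀ b ∈ Set.range a, P.Refuses p b} := by
  ext p
  simp only [Set.mem_ofPred_eq, Sat, Set.forall_mem_range, Refuses]

theorem sat_and (φ ψ : Obs A) :
    {p | P.Sat (φ.and ψ) p} = {p | p ∈ {p | P.Sat φ p} ∧ p ∈ {p | P.Sat ψ p}} := by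
  ext p
  simp only [Set.mem_ofPred_eq, Obs.and, Sat]
  exact ⟨fun h => ⟨h ⟨true⟩, h ⟨false⟩⟩, fun h b => by rcases b with ⟨_ | _⟩; exacts [h.2, h.1]⟩

theorem _root_.Obs.IsFailure.observable {φ : Obs A} (h : φ.IsFailure) :
    ∃ n, P.Observable False n {p | P.Sat φ p} := by
  induction h with
  | top => exact ⟨0, by simpa only [Sat, Set.ofPred_true] using .top 0⟩
  | act a φ _ ih => exact ih.imp' Nat.succ fun n hn => hn.act n a _
  | refusals a => exact ⟨0, by rw [sat_refusals]; exact .refusals 0 _⟩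

theorem _root_.Obs.IsFailureTrace.observable {φ : Obs A} (h : φ.IsFailureTrace) :
    ∃ n, P.Observable True n {p | P.Sat φ p} := by
  induction h with
  | top => exact ⟨0, by simpa only [Sat, Set.ofPred_true] using .top 0⟩
  | act a φ _ ih => exact ih.imp' Nat.succ fun n hn => hn.act n a _
  | refusals a φ _ ih =>
    refine ih.imp fun n hn => ?_
    rw [sat_and, sat_refusals]
    exact .refusalTrace n _ _ trivial hn

theorem Observable.exists_isFailure {n : ℕ} {Q : Set (ClosedTerm S V)}
    (h : P.Observable False n Q) : ∃ φ : Obs A, φ.IsFailure ∧ Q = {p | P.Sat φ p} := by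
  induction h with
  | top n => exact ⟨_, .top, by simp only [Sat, Set.ofPred_true]⟩
  | act n a Q _ ih =>
    obtain ⟨φ, hφ, rfl⟩ := ih
    exact ⟨_, hφ.act a φ, by simp only [Sat]; rfl⟩
  | refusals n B =>
    exact ⟨_, .refusals (fun b : B => b.1), by rw [sat_refusals, Subtype.range_coe]⟩
  | refusalTrace n B Q h => exact h.elim

theorem Observable.exists_isFailureTrace {n : ℕ} {Q : Set (ClosedTerm S V)}
    (h : P.Observable True n Q) : ∃ φ : Obs A, φ.IsFailureTrace ∧ Q = {p | P.Sat φ p} := by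
  induction h with
  | top n => exact ⟨_, .top, by simp only [Sat, Set.ofPred_true]⟩
  | act n a Q _ ih =>
    obtain ⟨φ, hφ, rfl⟩ := ih
    exact ⟨_, hφ.act a φ, by simp only [Sat]; rfl⟩
  | refusals n B =>
    -- Failure trace observations have no bare conjunction of refusals, so `⊤` is appended.
    exact ⟨_, .refusals (fun b : B => b.1) _ .top, by
      rw [sat_and, sat_refusals, Subtype.range_coe]; simp only [Set.mem_ofPred_eq, Sat, and_true]⟩
  | refusalTrace n B Q _ _ ih =>
    obtain ⟨φ, hφ, rfl⟩ := ih
    exact ⟨_, .refusals (fun b : B => b.1) _ hφ, by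
      rw [sat_and, sat_refusals, Subtype.range_coe]; rfl⟩

theorem failurePreorder_eq : P.FailurePreorder = P.ObsLE False := by
  funext p q
  refine propext ⟨fun h n Q hQ hp => ?_, fun h φ ⟨hφ, hp⟩ => ⟨hφ, ?_⟩⟩
  · obtain ⟨φ, hφ, rfl⟩ := hQ.exists_isFailure
    exact (h ⟨hφ, hp⟩).2
  · obtain ⟨n, hn⟩ := hφ.observable (P := P)
    exact h n _ hn hp

theorem failureTracePreorder_eq : P.FailureTracePreorder = P.ObsLE True := by
  funext p q
  refine propext ⟨fun h n Q hQ hp => ?_, fun h φ ⟨hφ, hp⟩ => ⟨hφ, ?_⟩⟩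
  · obtain ⟨φ, hφ, rfl⟩ := hQ.exists_isFailureTrace
    exact (h ⟨hφ, hp⟩).2
  · obtain ⟨n, hn⟩ := hφ.observable (P := P)
    exact h n _ hn hp

end TSS
end Decomposition

theorem mainTheorem3 {S : Signature.{u}} {V : Type v} {A : Type w} [Infinite V]
    (hA : Nonempty (A ↪ V)) (hS : Nonempty (S.Sym ↪ V))
    (P : TSS S V A) (hstd : P.IsStandard) (hP : P.InFailureTraceFormat) :
    IsPrecongruence P.FailureTracePreorder ∧ IsPrecongruence P.FailurePreorder := by
  rw [TSS.failureTracePreorder_eq, TSS.failurePreorder_eq]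
  exact ⟨TSS.isPrecongruence_obsLE hstd hP True, TSS.isPrecongruence_obsLE hstd hP False⟩
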